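/- Let $\mathcal X$ and $\mathcal A$ be finite alphabets, $\mathcal X\neq\emptyset$, and let $P_{Y|X}$ and $P_{Z|X}$ be channels (conditional distributions) from $\mathcal X$ to $\mathcal Y=\mathcal Z=\mathcal A$ with $P_{Y|X}=P_{Z|X}$. Assume that for each $y\in\mathcal Y$ there is $x\in\mathcal X$ with $P_{Y|X=x}(y)>0$, and likewise for each $z\in\mathcal Z$. Let $P_{YZ|X=x}(y,z):=P_{Y|X=x}(y)P_{Z|X=x}(z)$. $D(\cdot\|\cdot)$ denotes relative entropy. For a channel $P_{W|X}$ with input alphabet $\mathcal X$ and an input distribution $S_X$, write $D(P_{W|X}\|Q_W|S_X)$ for the relative entropy between the joint distributions $S_X(x)P_{W|X=x}(w)$ and $S_X(x)Q_W(w)$. The capacity of $P_{W|X}$ is $\sup_{S_X}I(X;W)$, where $I(X;W)=D(P_{W|X}\|\sum_xP_{W|X=x}S_X(x)\,|S_X)$, and a capacity-achieving output distribution of $P_{W|X}$ is a distribution $Q_W$ attaining the infimum in $\inf_{Q_W}\sup_{S_X}D(P_{W|X}\|Q_W|S_X)$. Then $P_{YZ|X}$ has exactly one capacity-achieving output distribution;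 denote it by $Q_{YZ}$. Its marginals $Q_Y,Q_Z$ are everywhere positive, so the conditional distributions below are well defined. Call $z,z'\in\mathcal Z$ equivalent if $Q_{Y|Z=z}=Q_{Y|Z=z'}$, and let $\underline z$ denote the equivalence class of $z$; similarly call $y,y'\in\mathcal Y$ equivalent if $Q_{Z|Y=y}=Q_{Z|Y=y'}$, and let $\underline y$ denote the class of $y$. Let $$\mathcal X_{\rm bad}:=\Big\{x\in\mathcal X:\ \exists z\ne z'\text{ with }\underline z=\underline z'\text{ but }\tfrac{P_{Z|X=x}(z)}{Q_Z(z)}\ne\tfrac{P_{Z|X=x}(z')}{Q_Z(z')}\Big\}.$$ Moreover: (1) For $\delta>0$ let $\Delta(\delta):=\sup_{S_X}S_X(\mathcal X_{\rm bad})$, the supremum being over all distributions $S_X$ on $\mathcal X$ with $D\big(\sum_{x}P_{YZ|X=x}S_X(x)\,\big\|\,Q_{YZ}\big)\le\delta$. Then $\Delta(\delta)=O(\sqrt\delta)$ as $\delta\downarrow0$ (for fixed channels; the constant may depend on them). (2) Let $P_{\underline Y\underline Z|X}$ be the channel from $\mathcal X$ obtained from $P_{YZ|X}$ by applying $(y,z)\mapsto(\underline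 y,\underline z)$ to its output, and let $Q_{\underline Y\underline Z}$ be the image of $Q_{YZ}$ under the same map. Then $P_{\underline Y\underline Z|X}$ has the same capacity as $P_{YZ|X}$, and $Q_{\underline Y\underline Z}$ is its unique capacity-achieving output distribution. -/

import Mathlib

open scoped ENNReal Topology Asymptotics

noncomputable section

namespace DMC

/-- Relative entropy `D(P‖Q)` (in nats) of two distributions on a discrete alphabet,
every subset of the alphabet being measurable. -/
def relEnt {α : Type*} (P Q : PMF α) : ℝ≥0∞ :=
  @InformationTheory.klDiv α ⊤ (@PMF.toMeasure α ⊤ P) (@PMF.toMeasure α ⊤ Q)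

/-- A channel (conditional distribution) from the input alphabet `X` to the output alphabet `Y`. -/
abbrev Channel (X Y : Type*) := X → PMF Y

/-- The joint distribution `(x, y) ↦ S(x) W(y|x)` of input and output. -/
def joint {X Y : Type*} (S : PMF X) (W : Channel X Y) : PMF (X × Y) :=
  S.bind fun x => (W x).map (Prod.mk x)

/-- The output distribution `y ↦ ∑ x, S(x) W(y|x)`. -/
def output {X Y : Type*} (S : PMF X) (W : Channel X Y) : PMF Y :=
  S.bind W

/-- Conditional relative entropy `D(W‖V|S) = D(S W‖S V)`. -/
def condRelEnt {X Y : Type*} (W V : Channel X Y) (S : PMF X) : ℝ≥0∞ :=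
  relEnt (joint S W) (joint S V)

/-- Mutual information `I(X;Y) = D(P_{Y|X}‖P_Y|P_X)` for input distribution `S` and channel `W`. -/
def mutualInfo {X Y : Type*} (S : PMF X) (W : Channel X Y) : ℝ≥0∞ :=
  condRelEnt W (fun _ => output S W) S

/-- Channel capacity `sup_{P_X} I(X;Y)`. -/
def capacity {X Y : Type*} (W : Channel X Y) : ℝ≥0∞ :=
  ⨆ S : PMF X, mutualInfo S W

/-- `Q` is a capacity-achieving output distribution of `W`: it attains the infimum in
`inf_Q sup_{P_X} D(W‖Q|P_X)`. -/
def IsCAOD {X Y : Type*} (W : Channel X Y) (Q : PMF Y) : Prop :=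
  ⨆ S : PMF X, condRelEnt W (fun _ => Q) S =
    ⨅ R : PMF Y, ⨆ S : PMF X, condRelEnt W (fun _ => R) S

/-- The channel `P_{YZ|X} = P_{Y|X} P_{Z|X}`: given the input, the two outputs are independent. -/
def prodChannel {X Y Z : Type*} (PY : Channel X Y) (PZ : Channel X Z) : Channel X (Y × Z) :=
  fun x => (PY x).bind fun y => (PZ x).map (Prod.mk y)

/-- Every output letter has positive probability under some input letter. -/
def Covers {X Y : Type*} (W : Channel X Y) : Prop :=
  ∀ y, ∃ x, 0 < W x y

/-- The marginal `Q_Y` of `Q = Q_{YZ}`. -/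
def margY {Y Z : Type*} (Q : PMF (Y × Z)) : PMF Y := Q.map Prod.fst

/-- The marginal `Q_Z` of `Q = Q_{YZ}`. -/
def margZ {Y Z : Type*} (Q : PMF (Y × Z)) : PMF Z := Q.map Prod.snd

/-- `y₁ ∼ y₂` iff `Q_{Z|Y=y₁} = Q_{Z|Y=y₂}` (used when `Q_Y` is positive everywhere). -/
def equivY {Y Z : Type*} (Q : PMF (Y × Z)) : Setoid Y :=
  Setoid.ker fun y => fun z => Q (y, z) / margY Q y

/-- `z₁ ∼ z₂` iff `Q_{Y|Z=z₁} = Q_{Y|Z=z₂}` (used when `Q_Z` is positive everywhere). -/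
def equivZ {Y Z : Type*} (Q : PMF (Y × Z)) : Setoid Z :=
  Setoid.ker fun z => fun y => Q (y, z) / margZ Q z

/-- The map `(y, z) ↦ (y̲, z̲)` sending both letters to their equivalence classes. -/
def under {Y Z : Type*} (Q : PMF (Y × Z)) :
    Y × Z → Quotient (equivY Q) × Quotient (equivZ Q) :=
  Prod.map (Quotient.mk (equivY Q)) (Quotient.mk (equivZ Q))

/-- The set `X_bad` of input letters `x` for which `P_{Z|X=x}(z) / Q_Z(z)` is not constant on
some equivalence class of letters `z`. -/
def bad {X Y Z : Type*} (PZ : Channel X Z) (Q : PMF (Y × Z)) : Set X :=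
  {x | ∃ z z' : Z, z ≠ z' ∧ (equivZ Q) z z' ∧ PZ x z / margZ Q z ≠ PZ x z' / margZ Q z'}

/-- `Δ(δ)`: the supremum of `S(B)` over all input distributions `S` whose output distribution
under `W` is within relative entropy `δ` of `Q`. -/
def Delta {X Y : Type*} (W : Channel X Y) (Q : PMF Y) (B : Set X) (δ : ℝ) : ℝ≥0∞ :=
  ⨆ S ∈ {S : PMF X | relEnt (output S W) Q ≤ ENNReal.ofReal δ}, S.toOuterMeasure B

end DMC

end

/-! A saddle point carries the proof. Mutual information is continuous on the simplex of input laws,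
so it has a maximiser `S`. Perturbing `S` towards a single letter shows that no row of the channel
has divergence above the capacity from the output of `S` (`relEnt_le_mutualInfo_of_isMax`). The
compensation identity `condRelEnt_const_eq_add` then makes this output, `Q`, the only optimal one
(`IsSaddle.isCAOD_iff`).

Let z, z' be equivalent. Since both outputs use the same channel, the average of (P_x(z)/Q_Z(z) −
P_x(z')/Q_Z(z'))² over any input law is linear in the joint output law, and it vanishes when that
law is `Q`. An output law within relative entropy δ of `Q` differs from it by at most 2√δ at each
pair, so every bad letter has mass O(√δ) (`exists_bound_of_mem_bad`).

At δ = 0 this says that the maximiser charges no bad letter. For the letters it does charge, the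
ratio P_{YZ|x}/Q is constant on products of classes, so merging letters loses no relative entropy
(`relEnt_map_under`); for the others data processing suffices. Hence the same `S` is a saddle for
the merged channel, which gives its capacity and its unique optimal output. -/

namespace DMC

/-! ### Relative entropy on a finite alphabet, letter by letter. -/

/-- The contribution of one letter to the relative entropy, normalised to be non-negative. -/
noncomputable def klTerm (p q : ℝ≥0∞) : ℝ≥0∞ :=
  open scoped Classical in
  if q = 0 ∧ p ≠ 0 then ⊤ else
    ENNReal.ofReal (p.toReal * Real.log (p.toReal / q.toReal) + q.toReal - p.toReal)

theorem klTerm_of_ac {p q : ℝ≥0∞} (h : q = 0 → p = 0) :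
    klTerm p q =
      ENNReal.ofReal (p.toReal * Real.log (p.toReal / q.toReal) + q.toReal - p.toReal) := by
  unfold klTerm
  rw [if_neg]
  tauto

theorem klTerm_zero_right {p : ℝ≥0∞} (h : p ≠ 0) : klTerm p 0 = ⊤ := by
  simp [klTerm, h]

theorem klTerm_mul (s p q : ℝ≥0∞) (hs : s ≠ ⊤) : klTerm (s * p) (s * q) = s * klTerm p q := by
  by_cases hs0 : s = 0
  · simp [hs0, klTerm]
  by_cases h : q = 0 → p = 0
  · rw [klTerm_of_ac h, klTerm_of_ac (by simpa [hs0] using h)]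
    have hs' : s.toReal ≠ 0 := (ENNReal.toReal_pos hs0 hs).ne'
    conv_rhs => rw [← ENNReal.ofReal_toReal hs, ← ENNReal.ofReal_mul ENNReal.toReal_nonneg]
    rw [ENNReal.toReal_mul, ENNReal.toReal_mul, mul_div_mul_left _ _ hs']
    congr 1
    ring
  · push Not at h
    rw [h.1, klTerm_zero_right h.2, mul_zero, klTerm_zero_right (mul_ne_zero hs0 h.2),
      ENNReal.mul_top hs0]

/-- This is log t ≤ t − 1 at t = √(q/p), multiplied by 2p: the squared Hellinger distance is
dominated letter by letter. -/
theorem sq_sqrt_sub_sqrt_le {p q : ℝ} (hp : 0 ≤ p) (hq : 0 ≤ q) (h : q = 0 → p = 0) :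
    (√p - √q) ^ 2 ≤ p * Real.log (p / q) + q - p := by
  rcases hp.eq_or_lt with rfl | hp
  · simp [Real.sq_sqrt hq]
  have hq : 0 < q := hq.lt_of_ne fun h' => hp.ne' (h h'.symm)
  have h1 : Real.log (√q / √p) ≤ √q / √p - 1 :=
    Real.log_le_sub_one_of_pos (div_pos (Real.sqrt_pos.2 hq) (Real.sqrt_pos.2 hp))
  have h2 : Real.log (p / q) = -2 * Real.log (√q / √p) := by
    rw [← Real.sqrt_div hq.le, Real.log_sqrt (div_pos hq hp).le, ← inv_div q p, Real.log_inv]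
    ring
  have h3 : p * (√q / √p) = √p * √q := by
    nth_rewrite 1 [← Real.mul_self_sqrt hp.le]
    field_simp
  rw [h2]
  nlinarith [Real.sq_sqrt hp.le, Real.sq_sqrt hq.le, mul_le_mul_of_nonneg_left h1 hp.le]

theorem klTerm_formula_nonneg {p q : ℝ} (hp : 0 ≤ p) (hq : 0 ≤ q) (h : q = 0 → p = 0) :
    0 ≤ p * Real.log (p / q) + q - p :=
  (sq_nonneg _).trans (sq_sqrt_sub_sqrt_le hp hq h)

theorem relEnt_eq_sum {α : Type*} [Fintype α] (P Q : PMF α) : relEnt P Q = ∑ a, klTerm (P a) (Q a) := by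
  let _ : MeasurableSpace α := ⊤
  unfold relEnt
  by_cases h : ∀ a, Q a = 0 → P a = 0
  · have hd : P.toMeasure = Q.toMeasure.withDensity fun a => P a / Q a := by
      refine MeasureTheory.Measure.ext_of_singleton fun a => ?_
      rw [MeasureTheory.withDensity_apply _ (MeasurableSet.singleton a), MeasureTheory.lintegral_singleton,
        PMF.toMeasure_apply_singleton _ _ (MeasurableSet.singleton a), PMF.toMeasure_apply_singleton _ _ (MeasurableSet.singleton a),
        ENNReal.div_mul_cancel' (h a) (fun h' => absurd h' (Q.apply_ne_top a))]
    have hac : P.toMeasure.AbsolutelyContinuous Q.toMeasure := by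
      rw [hd]; exact MeasureTheory.withDensity_absolutelyContinuous _ _
    have hr : (MeasureTheory.ae Q.toMeasure).EventuallyEq
        (P.toMeasure.rnDeriv Q.toMeasure) fun a => P a / Q a := by
      conv_lhs => rw [hd]
      exact MeasureTheory.Measure.rnDeriv_withDensity _ (measurable_from_top)
    rw [InformationTheory.klDiv_eq_lintegral_klFun_of_ac hac,
      MeasureTheory.lintegral_congr_ae (g := fun a =>
        ENNReal.ofReal (InformationTheory.klFun (P a / Q a).toReal))
        (f := fun a => ENNReal.ofReal
          (InformationTheory.klFun (P.toMeasure.rnDeriv Q.toMeasure a).toReal))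
        (hr.fun_comp fun r => ENNReal.ofReal (InformationTheory.klFun r.toReal)),
      MeasureTheory.lintegral_fintype]
    refine Finset.sum_congr rfl fun a _ => ?_
    rw [PMF.toMeasure_apply_singleton _ _ (MeasurableSet.singleton a), klTerm_of_ac (h a)]
    by_cases hq : Q a = 0
    · simp [hq, h a hq]
    have hq' : (Q a).toReal ≠ 0 := (ENNReal.toReal_pos hq (Q.apply_ne_top a)).ne'
    nth_rewrite 2 [← ENNReal.ofReal_toReal (Q.apply_ne_top a)]
    rw [← ENNReal.ofReal_mul (InformationTheory.klFun_nonneg ENNReal.toReal_nonneg),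
      InformationTheory.klFun_apply, ENNReal.toReal_div]
    congr 1
    field_simp
  · push Not at h
    obtain ⟨a, hQ, hP⟩ := h
    rw [InformationTheory.klDiv_of_not_ac]
    · symm
      rw [ENNReal.sum_eq_top]
      exact ⟨a, Finset.mem_univ _, by rw [hQ, klTerm_zero_right hP]⟩
    · intro hac
      refine hP ?_
      rw [← PMF.toMeasure_apply_singleton P a (MeasurableSet.singleton a)]
      exact hac (by rw [PMF.toMeasure_apply_singleton Q a (MeasurableSet.singleton a), hQ])

theorem klTerm_le_relEnt {α : Type*} [Fintype α] (P Q : PMF α) (a : α) : klTerm (P a) (Q a) ≤ relEnt P Q := by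
  rw [relEnt_eq_sum]
  exact Finset.single_le_sum (f := fun a => klTerm (P a) (Q a)) (fun _ _ => zero_le) (Finset.mem_univ a)

theorem eq_zero_of_relEnt_ne_top {α : Type*} [Fintype α] {P Q : PMF α} (h : relEnt P Q ≠ ⊤) {a : α} (ha : Q a = 0) :
    P a = 0 := by
  by_contra hP
  have := klTerm_le_relEnt P Q a
  rw [ha, klTerm_zero_right hP, top_le_iff] at this
  exact h this

/-- A Pinsker-type bound: factor p − q = (√p − √q)(√p + √q), where the Hellinger bound controls the
first factor and the second is at most 2. -/
theorem abs_sub_le_of_relEnt_le {α : Type*} [Fintype α] {P Q : PMF α} {δ : ℝ} (hδ : 0 ≤ δ)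
    (h : relEnt P Q ≤ ENNReal.ofReal δ) (a : α) :
    |(P a).toReal - (Q a).toReal| ≤ 2 * √δ := by
  have hac : Q a = 0 → P a = 0 := fun ha =>
    eq_zero_of_relEnt_ne_top (ne_top_of_le_ne_top ENNReal.ofReal_ne_top h) ha
  have hac' : (Q a).toReal = 0 → (P a).toReal = 0 := by
    simpa [ENNReal.toReal_eq_zero_iff, P.apply_ne_top, Q.apply_ne_top] using hac
  have h1 := (klTerm_le_relEnt P Q a).trans h
  rw [klTerm_of_ac hac, ENNReal.ofReal_le_ofReal_iff hδ] at h1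
  have h2 := (sq_sqrt_sub_sqrt_le ENNReal.toReal_nonneg ENNReal.toReal_nonneg hac').trans h1
  have h3 : |√(P a).toReal - √(Q a).toReal| ≤ √δ := Real.abs_le_sqrt h2
  have hle : ∀ R : PMF α, √(R a).toReal ≤ 1 := fun R => by
    rw [Real.sqrt_le_one]
    exact ENNReal.toReal_le_of_le_ofReal zero_le_one (by simpa using R.coe_le_one a)
  have h4 : (P a).toReal - (Q a).toReal =
      (√(P a).toReal - √(Q a).toReal) * (√(P a).toReal + √(Q a).toReal) := by
    nth_rewrite 1 [← Real.sq_sqrt (ENNReal.toReal_nonneg (a := P a)),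
      ← Real.sq_sqrt (ENNReal.toReal_nonneg (a := Q a))]
    ring
  rw [h4, abs_mul, abs_of_nonneg (add_nonneg (Real.sqrt_nonneg _) (Real.sqrt_nonneg _)), mul_comm]
  exact mul_le_mul (by linarith [hle P, hle Q]) h3 (abs_nonneg _) zero_le_two

theorem relEnt_self {α : Type*} (P : PMF α) : relEnt P P = 0 :=
  let _ : MeasurableSpace α := ⊤
  InformationTheory.klDiv_self _

theorem eq_of_relEnt_eq_zero {α : Type*} {P Q : PMF α} (h : relEnt P Q = 0) : P = Q := by
  let _ : MeasurableSpace α := ⊤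
  exact PMF.toMeasure_injective (InformationTheory.klDiv_eq_zero_iff.1 h)

theorem relEnt_map_le {α β : Type*} (P Q : PMF α) (f : α → β) :
    relEnt (P.map f) (Q.map f) ≤ relEnt P Q := by
  let _ : MeasurableSpace α := ⊤
  let _ : MeasurableSpace β := ⊤
  unfold relEnt
  rw [← PMF.toMeasure_map _ P measurable_from_top, ← PMF.toMeasure_map _ Q measurable_from_top]
  exact InformationTheory.klDiv_map_le _ _ measurable_from_top

open scoped Classical in
theorem map_apply_eq_sum {α β : Type*} [Fintype α] (P : PMF α) (f : α → β) (b : β) :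
    P.map f b = ∑ a with f a = b, P a := by
  rw [PMF.map_apply, tsum_fintype, Finset.sum_filter]
  simp only [eq_comm]

/-- No relative entropy is lost under a map `f` through which the likelihood ratio factors. -/
theorem relEnt_map_eq {α β : Type*} [Fintype α] [Fintype β] {P Q : PMF α} (f : α → β)
    (hac : ∀ a, Q a = 0 → P a = 0) (h : ∀ a b, f a = f b → P a * Q b = P b * Q a) :
    relEnt (P.map f) (Q.map f) = relEnt P Q := by
  classical
  -- The likelihood ratio is a constant `g` on each fibre; a fibre that is null for `Q` is null for
  -- `P` too, so 0 serves there.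
  have hg : ∀ c, ∃ g : ℝ≥0∞, ∀ a, f a = c → P a = Q a * g := by
    intro c
    by_cases hc : ∃ b, f b = c ∧ Q b ≠ 0
    · obtain ⟨b, rfl, hb⟩ := hc
      refine ⟨P b / Q b, fun a ha => ?_⟩
      rw [← mul_div_assoc, ENNReal.eq_div_iff hb (Q.apply_ne_top b), mul_comm, h a b ha, mul_comm]
    · push Not at hc
      exact ⟨0, fun a ha => by rw [hac a (hc a ha), mul_zero]⟩
  choose g hg using hg
  rw [relEnt_eq_sum, relEnt_eq_sum, ← Finset.sum_fiberwise _ f]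
  refine Finset.sum_congr rfl fun c _ => ?_
  have h1 : P.map f c = Q.map f c * g c := by
    rw [map_apply_eq_sum, map_apply_eq_sum, Finset.sum_mul]
    exact Finset.sum_congr rfl fun a ha => hg c a (Finset.mem_filter.1 ha).2
  -- With the ratio fixed, `klTerm` is linear in its second argument, so summing over a fibre is
  -- exact.
  have h2 : ∀ q : ℝ≥0∞, q ≠ ⊤ → klTerm (q * g c) q = q * klTerm (g c) 1 := fun q hq => by
    simpa using klTerm_mul q (g c) 1 hq
  rw [h1, h2 _ (PMF.apply_ne_top _ _), map_apply_eq_sum, Finset.sum_mul]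
  refine Finset.sum_congr rfl fun a ha => ?_
  rw [hg c a (Finset.mem_filter.1 ha).2, h2 _ (Q.apply_ne_top a)]

/-! ### Channels as finite sums, and the compensation identity. -/

theorem joint_apply {X Y : Type*} (S : PMF X) (W : Channel X Y) (x : X) (y : Y) :
    joint S W (x, y) = S x * W x y := by
  classical
  rw [joint, PMF.bind_apply, tsum_eq_single x]
  · rw [PMF.map_apply, tsum_eq_single y] <;> simp +contextual [eq_comm]
  · intro x' hx'
    simp [PMF.map_apply, hx'.symm]

theorem output_apply {X Y : Type*} [Fintype X] (S : PMF X) (W : Channel X Y) (y : Y) :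
    output S W y = ∑ x, S x * W x y := by
  rw [output, PMF.bind_apply, tsum_fintype]

theorem prodChannel_apply {X Y Z : Type*} (PY : Channel X Y) (PZ : Channel X Z) (x : X) (y : Y)
    (z : Z) : prodChannel PY PZ x (y, z) = PY x y * PZ x z := by
  classical
  rw [prodChannel, PMF.bind_apply, tsum_eq_single y]
  · rw [PMF.map_apply, tsum_eq_single z] <;> simp +contextual [eq_comm]
  · intro y' hy'
    simp [PMF.map_apply, hy'.symm]

theorem condRelEnt_eq_sum {X Y : Type*} [Fintype X] [Fintype Y] (W V : Channel X Y) (S : PMF X) :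
    condRelEnt W V S = ∑ x, S x * relEnt (W x) (V x) := by
  rw [condRelEnt, relEnt_eq_sum, Fintype.sum_prod_type]
  refine Finset.sum_congr rfl fun x _ => ?_
  rw [relEnt_eq_sum, Finset.mul_sum]
  refine Finset.sum_congr rfl fun y _ => ?_
  rw [joint_apply, joint_apply, klTerm_mul _ _ _ (S.apply_ne_top x)]

theorem sum_apply_eq_one {X : Type*} [Fintype X] (S : PMF X) : ∑ x, S x = 1 := by
  rw [← S.tsum_coe, tsum_fintype]

/-- Conditional relative entropy is an average over the input law, so point masses already attain
the supremum. -/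
theorem iSup_condRelEnt {X Y : Type*} [Fintype X] [Fintype Y] (W : Channel X Y) (R : PMF Y) :
    ⨆ S : PMF X, condRelEnt W (fun _ => R) S = ⨆ x, relEnt (W x) R := by
  classical
  refine le_antisymm (iSup_le fun S => ?_) (iSup_le fun x => ?_)
  · rw [condRelEnt_eq_sum]
    calc ∑ x, S x * relEnt (W x) R ≤ ∑ x, S x * ⨆ x, relEnt (W x) R :=
          Finset.sum_le_sum fun x _ => by gcongr; exact le_iSup (fun x => relEnt (W x) R) x
      _ = _ := by rw [← Finset.sum_mul, sum_apply_eq_one, one_mul]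
  · refine le_trans (le_of_eq ?_) (le_iSup _ (PMF.pure x))
    rw [condRelEnt_eq_sum, Finset.sum_eq_single x] <;> simp +contextual [PMF.pure_apply]

theorem toReal_output_apply {X Y : Type*} [Fintype X] (S : PMF X) (W : Channel X Y) (y : Y) :
    (output S W y).toReal = ∑ x, (S x).toReal * (W x y).toReal := by
  rw [output_apply, ENNReal.toReal_sum
    fun x _ => ENNReal.mul_ne_top (S.apply_ne_top x) ((W x).apply_ne_top y)]
  simp only [ENNReal.toReal_mul]

theorem sum_toReal_eq_one {X : Type*} [Fintype X] (S : PMF X) : ∑ x, (S x).toReal = 1 := by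
  rw [← ENNReal.toReal_sum fun x _ => S.apply_ne_top x, sum_apply_eq_one, ENNReal.toReal_one]

theorem toReal_eq_zero_imp {p q : ℝ≥0∞} (hq : q ≠ ⊤) (h : q = 0 → p = 0) :
    q.toReal = 0 → p.toReal = 0 := fun h' => by
  rw [h ((ENNReal.toReal_eq_zero_iff q).1 h' |>.resolve_right hq), ENNReal.toReal_zero]

/-- Moves weighted sums to the reals. Absolute continuity is needed only where the weight is
nonzero, since a zero weight annihilates even `⊤`. -/
theorem sum_mul_klTerm {X : Type*} [Fintype X] {s p q : X → ℝ≥0∞} (hs : ∀ x, s x ≠ ⊤)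
    (hq : ∀ x, q x ≠ ⊤) (h : ∀ x, s x ≠ 0 → q x = 0 → p x = 0) :
    ∑ x, s x * klTerm (p x) (q x) = ENNReal.ofReal (∑ x, (s x).toReal *
      ((p x).toReal * Real.log ((p x).toReal / (q x).toReal) + (q x).toReal - (p x).toReal)) ∧
    0 ≤ ∑ x, (s x).toReal *
      ((p x).toReal * Real.log ((p x).toReal / (q x).toReal) + (q x).toReal - (p x).toReal) := by
  have hnn : ∀ x ∈ Finset.univ, 0 ≤ (s x).toReal *
      ((p x).toReal * Real.log ((p x).toReal / (q x).toReal) + (q x).toReal - (p x).toReal) := by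
    intro x _
    by_cases h0 : s x = 0
    · simp [h0]
    · exact mul_nonneg ENNReal.toReal_nonneg (klTerm_formula_nonneg ENNReal.toReal_nonneg
        ENNReal.toReal_nonneg (toReal_eq_zero_imp (hq x) (h x h0)))
  refine ⟨?_, Finset.sum_nonneg hnn⟩
  rw [ENNReal.ofReal_sum_of_nonneg hnn]
  refine Finset.sum_congr rfl fun x _ => ?_
  by_cases h0 : s x = 0
  · simp [h0]
  rw [klTerm_of_ac (h x h0), ENNReal.ofReal_mul ENNReal.toReal_nonneg, ENNReal.ofReal_toReal (hs x)]

theorem eq_zero_of_output_eq_zero {X Y : Type*} [Fintype X] {S : PMF X} {W : Channel X Y} {y : Y}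
    (h : output S W y = 0) {x : X} (hx : S x ≠ 0) : W x y = 0 := by
  rw [output_apply, Finset.sum_eq_zero_iff] at h
  exact (mul_eq_zero.1 (h x (Finset.mem_univ x))).resolve_left hx

/-- Average log(w/r) = log(w/o) + log(o/r) over the input, with o the output probability of the
letter. -/
theorem sum_mul_klTerm_eq_add {X Y : Type*} [Fintype X] (S : PMF X) (W : Channel X Y)
    (R : PMF Y) (y : Y) :
    ∑ x, S x * klTerm (W x y) (R y) =
      ∑ x, S x * klTerm (W x y) (output S W y) + klTerm (output S W y) (R y) := by
  by_cases h : R y = 0 → output S W y = 0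
  · obtain ⟨h1, -⟩ := sum_mul_klTerm (s := S) (p := fun x => W x y) (q := fun _ => R y)
      S.apply_ne_top (fun _ => R.apply_ne_top y)
      (fun x hx h' => eq_zero_of_output_eq_zero (h h') hx)
    obtain ⟨h2, h2'⟩ := sum_mul_klTerm (s := S) (p := fun x => W x y) (q := fun _ => output S W y)
      S.apply_ne_top (fun _ => PMF.apply_ne_top _ y)
      (fun x hx h' => eq_zero_of_output_eq_zero h' hx)
    have hR := toReal_eq_zero_imp (R.apply_ne_top y) h
    rw [h1, h2, klTerm_of_ac h, ← ENNReal.ofReal_add h2'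
      (klTerm_formula_nonneg ENNReal.toReal_nonneg ENNReal.toReal_nonneg hR)]
    congr 1
    have ho := toReal_output_apply S W y
    set o := (output S W y).toReal
    set r := (R y).toReal
    have hx : ∀ x, (S x).toReal * ((W x y).toReal * Real.log ((W x y).toReal / r) + r
        - (W x y).toReal) = (S x).toReal * ((W x y).toReal * Real.log ((W x y).toReal / o) + o
        - (W x y).toReal) + ((S x).toReal * (W x y).toReal * Real.log (o / r)
          + (S x).toReal * (r - o)) := by
      intro x
      -- Off the support the logarithms may be junk, but each is multiplied by zero.
      by_cases h0 : (S x).toReal * (W x y).toReal = 0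
      · rcases mul_eq_zero.1 h0 with h0 | h0 <;> (simp [h0]; try ring)
      · have hpos : 0 < (S x).toReal * (W x y).toReal :=
          lt_of_le_of_ne (by positivity) (Ne.symm h0)
        have hopos : o ≠ 0 := by
          rw [ho]
          exact (hpos.trans_le (Finset.single_le_sum
            (f := fun x => (S x).toReal * (W x y).toReal) (fun _ _ => by positivity)
            (Finset.mem_univ x))).ne'
        have hw : (W x y).toReal ≠ 0 := (mul_ne_zero_iff.1 h0).2
        rw [Real.log_div hw (fun h' => hopos (hR h')), Real.log_div hw hopos,
          Real.log_div hopos (fun h' => hopos (hR h'))]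
        ring
    rw [Finset.sum_congr rfl fun x _ => hx x, Finset.sum_add_distrib, Finset.sum_add_distrib,
      ← Finset.sum_mul, ← Finset.sum_mul, ← ho, sum_toReal_eq_one]
    ring
  · push Not at h
    rw [h.1, klTerm_zero_right h.2, add_top, ENNReal.sum_eq_top]
    have h' := h.2
    rw [output_apply] at h'
    obtain ⟨x, -, hx⟩ := Finset.exists_ne_zero_of_sum_ne_zero h'
    rw [mul_ne_zero_iff] at hx
    exact ⟨x, Finset.mem_univ x, by rw [klTerm_zero_right hx.2, ENNReal.mul_top hx.1]⟩

/-- The compensation identity. -/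
theorem condRelEnt_const_eq_add {X Y : Type*} [Fintype X] [Fintype Y] (S : PMF X)
    (W : Channel X Y) (R : PMF Y) :
    condRelEnt W (fun _ => R) S = mutualInfo S W + relEnt (output S W) R := by
  simp only [mutualInfo, condRelEnt_eq_sum, relEnt_eq_sum, Finset.mul_sum]
  rw [Finset.sum_comm, Finset.sum_comm (f := fun x y => S x * klTerm (W x y) (output S W y)),
    ← Finset.sum_add_distrib]
  exact Finset.sum_congr rfl fun y _ => sum_mul_klTerm_eq_add S W R y

/-! ### Existence of a saddle point. -/

/-- Only t log t occurs and no quotient, so the expression is visibly finite and continuous in the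
input law. -/
theorem mutualInfo_eq_ofReal {X Y : Type*} [Fintype X] [Fintype Y] (S : PMF X)
    (W : Channel X Y) :
    mutualInfo S W = ENNReal.ofReal (∑ y, (∑ x, (S x).toReal *
      ((W x y).toReal * Real.log (W x y).toReal) -
      (∑ x, (S x).toReal * (W x y).toReal) *
        Real.log (∑ x, (S x).toReal * (W x y).toReal))) := by
  simp only [mutualInfo, condRelEnt_eq_sum, relEnt_eq_sum, Finset.mul_sum]
  rw [Finset.sum_comm]
  have key : ∀ y, ∑ x, S x * klTerm (W x y) (output S W y) =
      ENNReal.ofReal (∑ x, (S x).toReal * ((W x y).toReal * Real.log (W x y).toReal) -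
      (∑ x, (S x).toReal * (W x y).toReal) *
        Real.log (∑ x, (S x).toReal * (W x y).toReal)) ∧
      0 ≤ ∑ x, (S x).toReal * ((W x y).toReal * Real.log (W x y).toReal) -
      (∑ x, (S x).toReal * (W x y).toReal) *
        Real.log (∑ x, (S x).toReal * (W x y).toReal) := by
    intro y
    have h2 := sum_mul_klTerm (s := S) (p := fun x => W x y) (q := fun _ => output S W y)
      S.apply_ne_top (fun _ => PMF.apply_ne_top _ y)
      (fun x hx h' => eq_zero_of_output_eq_zero h' hx)
    have ho := toReal_output_apply S W y
    rw [← ho]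
    set o := (output S W y).toReal
    have hx : ∀ x, (S x).toReal * ((W x y).toReal * Real.log ((W x y).toReal / o) + o
        - (W x y).toReal) = (S x).toReal * ((W x y).toReal * Real.log (W x y).toReal)
        - (S x).toReal * (W x y).toReal * Real.log o
        + ((S x).toReal * o - (S x).toReal * (W x y).toReal) := by
      intro x
      by_cases h0 : (S x).toReal * (W x y).toReal = 0
      · rcases mul_eq_zero.1 h0 with h0 | h0 <;> simp [h0]
      · have hpos : 0 < (S x).toReal * (W x y).toReal :=
          lt_of_le_of_ne (by positivity) (Ne.symm h0)
        have hopos : o ≠ 0 := by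
          rw [ho]
          exact (hpos.trans_le (Finset.single_le_sum
            (f := fun x => (S x).toReal * (W x y).toReal) (fun _ _ => by positivity)
            (Finset.mem_univ x))).ne'
        rw [Real.log_div (mul_ne_zero_iff.1 h0).2 hopos]
        ring
    rw [Finset.sum_congr rfl fun x _ => hx x, Finset.sum_add_distrib, Finset.sum_sub_distrib,
      Finset.sum_sub_distrib, ← Finset.sum_mul, ← Finset.sum_mul, ← ho, sum_toReal_eq_one,
      one_mul, sub_self, add_zero] at h2
    exact h2
  rw [ENNReal.ofReal_sum_of_nonneg fun y _ => (key y).2]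
  exact Finset.sum_congr rfl fun y _ => (key y).1

theorem exists_pmf_toReal_eq {X : Type*} [Fintype X] {s : X → ℝ} (hs : s ∈ stdSimplex ℝ X) :
    ∃ S : PMF X, ∀ x, S x = ENNReal.ofReal (s x) :=
  ⟨PMF.ofFintype (fun x => ENNReal.ofReal (s x)) (by
    rw [← ENNReal.ofReal_sum_of_nonneg fun x _ => hs.1 x, hs.2, ENNReal.ofReal_one]), fun _ => rfl⟩

theorem exists_forall_mutualInfo_le {X Y : Type*} [Fintype X] [Nonempty X] [Fintype Y]
    (W : Channel X Y) : ∃ S : PMF X, ∀ T : PMF X, mutualInfo T W ≤ mutualInfo S W := by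
  classical
  let F : (X → ℝ) → ℝ := fun s => ∑ y, (∑ x, s x *
      ((W x y).toReal * Real.log (W x y).toReal) -
      (∑ x, s x * (W x y).toReal) * Real.log (∑ x, s x * (W x y).toReal))
  have hF : Continuous F := by
    refine continuous_finsetSum _ fun y _ => Continuous.sub (by fun_prop) ?_
    exact Real.continuous_mul_log.comp (by fun_prop : Continuous fun s : X → ℝ =>
      ∑ x, s x * (W x y).toReal)
  have hmem : ∀ T : PMF X, (fun x => (T x).toReal) ∈ stdSimplex ℝ X := fun T =>
    ⟨fun x => ENNReal.toReal_nonneg, sum_toReal_eq_one T⟩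
  obtain ⟨s, hs, hmax⟩ := (isCompact_stdSimplex ℝ X).exists_isMaxOn
    ⟨_, hmem (PMF.pure (Classical.arbitrary X))⟩ hF.continuousOn
  obtain ⟨S, hS⟩ := exists_pmf_toReal_eq hs
  refine ⟨S, fun T => ?_⟩
  rw [mutualInfo_eq_ofReal, mutualInfo_eq_ofReal]
  refine ENNReal.ofReal_le_ofReal ?_
  have hS' : (fun x => (S x).toReal) = s := by
    funext x
    rw [hS, ENNReal.toReal_ofReal (hs.1 x)]
  have := hmax (hmem T)
  rw [← hS'] at this
  exact this

/-- When q = 0 < p the term grows like −p log t, matching the value `⊤` at the limit; hence no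
absolute continuity has to be known in advance. -/
theorem tendsto_klTerm_mix {p q : ℝ≥0∞} (hp : p ≠ ⊤) (hq : q ≠ ⊤) :
    Filter.Tendsto (fun t : ℝ => klTerm p (ENNReal.ofReal (1 - t) * q + ENNReal.ofReal t * p))
      (𝓝[>] 0) (𝓝 (klTerm p q)) := by
  have hev : ∀ᶠ t : ℝ in 𝓝[>] 0, t ∈ Set.Ioo (0 : ℝ) 1 := Ioo_mem_nhdsGT one_pos
  have hform : ∀ᶠ t : ℝ in 𝓝[>] 0,
      ENNReal.ofReal (p.toReal * Real.log (p.toReal / ((1 - t) * q.toReal + t * p.toReal)) +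
        ((1 - t) * q.toReal + t * p.toReal) - p.toReal) =
      klTerm p (ENNReal.ofReal (1 - t) * q + ENNReal.ofReal t * p) := by
    filter_upwards [hev] with t ht
    rw [klTerm_of_ac, ENNReal.toReal_add, ENNReal.toReal_mul, ENNReal.toReal_mul,
      ENNReal.toReal_ofReal ht.1.le, ENNReal.toReal_ofReal (by linarith [ht.2])]
    · exact ENNReal.mul_ne_top ENNReal.ofReal_ne_top hq
    · exact ENNReal.mul_ne_top ENNReal.ofReal_ne_top hp
    · intro h
      have h1 := (add_eq_zero.1 h).2
      exact (mul_eq_zero.1 h1).resolve_left (ENNReal.ofReal_pos.2 ht.1).ne'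
  refine Filter.Tendsto.congr' hform ?_
  by_cases h : q = 0 → p = 0
  · rw [klTerm_of_ac h]
    refine ENNReal.tendsto_ofReal ?_
    by_cases hp0 : p = 0
    · refine (Continuous.tendsto' ?_ 0 _ ?_).mono_left nhdsWithin_le_nhds
      · simp only [hp0, ENNReal.toReal_zero, zero_mul]
        fun_prop
      · simp [hp0]
    · have hq0 : q.toReal ≠ 0 := (ENNReal.toReal_pos (fun h' => hp0 (h h')) hq).ne'
      have hp0' : p.toReal ≠ 0 := (ENNReal.toReal_pos hp0 hp).ne'
      have hc : ContinuousAt (fun t : ℝ => p.toReal *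
          Real.log (p.toReal / ((1 - t) * q.toReal + t * p.toReal)) +
          ((1 - t) * q.toReal + t * p.toReal) - p.toReal) 0 := by
        have h1 : ContinuousAt (fun t : ℝ => (1 - t) * q.toReal + t * p.toReal) 0 := by fun_prop
        refine ((continuousAt_const.mul (ContinuousAt.log (continuousAt_const.div h1 ?_) ?_)).add
          h1).sub continuousAt_const
        · simpa using hq0
        · simpa using ⟨hp0', hq0⟩
      have := hc.tendsto
      simp only [sub_zero, one_mul, zero_mul, add_zero] at this
      exact this.mono_left nhdsWithin_le_nhds
  · push Not at h
    rw [h.1, klTerm_zero_right h.2]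
    have hp0 : 0 < p.toReal := ENNReal.toReal_pos h.2 hp
    refine ENNReal.tendsto_ofReal_nhds_top.2 ?_
    have h1 : Filter.Tendsto (fun t : ℝ => p.toReal * (-Real.log t) - p.toReal) (𝓝[>] 0)
        Filter.atTop :=
      Filter.tendsto_atTop_add_const_right _ _
        ((Filter.tendsto_neg_atBot_atTop.comp Real.tendsto_log_nhdsGT_zero).const_mul_atTop hp0)
    refine Filter.tendsto_atTop_mono' _ ?_ h1
    filter_upwards [hev] with t ht
    have h2 : p.toReal / ((1 - t) * (0 : ℝ≥0∞).toReal + t * p.toReal) = t⁻¹ := by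
      have := ht.1.ne'
      simp only [ENNReal.toReal_zero]
      field_simp
      ring
    rw [h2, Real.log_inv]
    have := mul_pos ht.1 hp0
    simp only [ENNReal.toReal_zero]
    linarith

/-- At an input distribution maximising the mutual information, every input letter has divergence
at most the capacity from the output distribution. -/
theorem relEnt_le_mutualInfo_of_isMax {X Y : Type*} [Fintype X] [Fintype Y] {W : Channel X Y}
    {S : PMF X} (hS : ∀ T : PMF X, mutualInfo T W ≤ mutualInfo S W) (x : X) :
    relEnt (W x) (output S W) ≤ mutualInfo S W := by
  classical
  have hfin : mutualInfo S W ≠ ⊤ := by rw [mutualInfo_eq_ofReal]; exact ENNReal.ofReal_ne_top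
  rw [relEnt_eq_sum]
  -- It suffices to bound the divergence from the output of `T`, the mixture of `S` with a mass `t`
  -- at `x`, and let `t` tend to 0.
  refine le_of_tendsto (tendsto_finsetSum _ fun y _ =>
    tendsto_klTerm_mix ((W x).apply_ne_top y) (PMF.apply_ne_top _ y)) ?_
  filter_upwards [Ioo_mem_nhdsGT (one_pos (α := ℝ))] with t ht
  have ht1 : ENNReal.ofReal (1 - t) + ENNReal.ofReal t = 1 := by
    rw [← ENNReal.ofReal_add (by linarith [ht.2]) ht.1.le, sub_add_cancel, ENNReal.ofReal_one]
  obtain ⟨T, hT⟩ : ∃ T : PMF X, ∀ x', T x' =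
      ENNReal.ofReal (1 - t) * S x' + ENNReal.ofReal t * PMF.pure x x' :=
    ⟨PMF.ofFintype (fun x' => ENNReal.ofReal (1 - t) * S x' + ENNReal.ofReal t * PMF.pure x x')
      (by rw [Finset.sum_add_distrib, ← Finset.mul_sum, ← Finset.mul_sum, sum_apply_eq_one,
        sum_apply_eq_one, mul_one, mul_one, ht1]), fun _ => rfl⟩
  have hsum : ∀ f : X → ℝ≥0∞, ∑ x', T x' * f x' =
      ENNReal.ofReal (1 - t) * ∑ x', S x' * f x' + ENNReal.ofReal t * f x := by
    intro f
    have : ∑ x', PMF.pure x x' * f x' = f x := by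
      rw [Finset.sum_eq_single x] <;> simp +contextual [PMF.pure_apply]
    rw [← this, Finset.mul_sum, Finset.mul_sum, ← Finset.sum_add_distrib]
    exact Finset.sum_congr rfl fun x' _ => by rw [hT]; ring
  have hout : ∀ y, output T W y =
      ENNReal.ofReal (1 - t) * output S W y + ENNReal.ofReal t * W x y := fun y => by
    rw [output_apply, output_apply, hsum]
  simp only [← hout]
  rw [← relEnt_eq_sum]
  -- Measuring the `S` part against `output T W` only increases it, and optimality of `S` bounds the
  -- total. The common term is finite and cancels, and then so does `t`.
  have h1 : ENNReal.ofReal (1 - t) * mutualInfo S W +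
      ENNReal.ofReal t * relEnt (W x) (output T W) ≤
      ENNReal.ofReal (1 - t) * mutualInfo S W + ENNReal.ofReal t * mutualInfo S W := by
    calc _ ≤ ENNReal.ofReal (1 - t) * condRelEnt W (fun _ => output T W) S +
          ENNReal.ofReal t * relEnt (W x) (output T W) := by
          gcongr
          rw [condRelEnt_const_eq_add]
          exact le_self_add
      _ = mutualInfo T W := by
          rw [mutualInfo, condRelEnt_eq_sum, condRelEnt_eq_sum, hsum]
      _ ≤ mutualInfo S W := hS T
      _ = _ := by rw [← add_mul, ht1, one_mul]
  have h2 := (ENNReal.add_le_add_iff_left (ENNReal.mul_ne_top ENNReal.ofReal_ne_top hfin)).1 h1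
  exact (ENNReal.mul_le_mul_iff_right (ENNReal.ofReal_pos.2 ht.1).ne' ENNReal.ofReal_ne_top).1 h2

/-- `S` is an input distribution from whose output distribution no row of `W` has divergence
exceeding the mutual information of `S`. -/
def IsSaddle {X Y : Type*} (W : Channel X Y) (S : PMF X) : Prop :=
  ∀ x, relEnt (W x) (output S W) ≤ mutualInfo S W

theorem exists_isSaddle {X Y : Type*} [Fintype X] [Nonempty X] [Fintype Y] (W : Channel X Y) :
    ∃ S : PMF X, IsSaddle W S :=
  (exists_forall_mutualInfo_le W).imp fun _ h => relEnt_le_mutualInfo_of_isMax h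

theorem mutualInfo_ne_top {X Y : Type*} [Fintype X] [Fintype Y] (W : Channel X Y) (S : PMF X) :
    mutualInfo S W ≠ ⊤ := by
  rw [mutualInfo_eq_ofReal]
  exact ENNReal.ofReal_ne_top

theorem IsSaddle.iSup_condRelEnt_le {X Y : Type*} [Fintype X] [Fintype Y] {W : Channel X Y}
    {S : PMF X} (h : IsSaddle W S) :
    ⨆ T : PMF X, condRelEnt W (fun _ => output S W) T ≤ mutualInfo S W := by
  rw [iSup_condRelEnt]
  exact iSup_le h

theorem IsSaddle.capacity_eq {X Y : Type*} [Fintype X] [Fintype Y] {W : Channel X Y}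
    {S : PMF X} (h : IsSaddle W S) : capacity W = mutualInfo S W := by
  refine le_antisymm (iSup_le fun T => ?_) (le_iSup (fun T => mutualInfo T W) S)
  refine le_trans ?_ ((le_iSup _ T).trans h.iSup_condRelEnt_le)
  rw [condRelEnt_const_eq_add]
  exact le_self_add

/-- By the compensation identity, a competitor `R` costs at least the mutual information plus its
divergence from `output S W`, an excess that vanishes only at equality. -/
theorem IsSaddle.isCAOD_iff {X Y : Type*} [Fintype X] [Fintype Y] {W : Channel X Y}
    {S : PMF X} (h : IsSaddle W S) (R : PMF Y) : IsCAOD W R ↔ R = output S W := by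
  have hge : ∀ R : PMF Y, mutualInfo S W + relEnt (output S W) R ≤
      ⨆ T : PMF X, condRelEnt W (fun _ => R) T := fun R => by
    rw [← condRelEnt_const_eq_add]
    exact le_iSup (fun T => condRelEnt W (fun _ => R) T) S
  have hinf : ⨅ R : PMF Y, ⨆ T : PMF X, condRelEnt W (fun _ => R) T = mutualInfo S W :=
    le_antisymm ((iInf_le _ _).trans h.iSup_condRelEnt_le)
      (le_iInf fun R => le_self_add.trans (hge R))
  rw [IsCAOD, hinf]
  constructor
  · intro hR
    have h1 : mutualInfo S W + relEnt (output S W) R ≤ mutualInfo S W + 0 := by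
      rw [add_zero]; exact (hge R).trans hR.le
    exact (eq_of_relEnt_eq_zero (le_zero_iff.1
      ((ENNReal.add_le_add_iff_left (mutualInfo_ne_top W S)).1 h1))).symm
  · rintro rfl
    exact le_antisymm h.iSup_condRelEnt_le (le_self_add.trans (hge _))

/-! ### Bad letters have small mass. -/

theorem exists_bound_of_mem_bad {X A : Type*} [Fintype X] [Fintype A] {P : Channel X A}
    {Q : PMF (A × A)} (hpos : ∀ z, 0 < margZ Q z) {x : X} (hx : x ∈ bad P Q) :
    ∃ M : ℝ, ∀ (S : PMF X) (δ : ℝ), 0 ≤ δ →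
      relEnt (output S (prodChannel P P)) Q ≤ ENNReal.ofReal δ → (S x).toReal ≤ M * √δ := by
  obtain ⟨z, z', -, hzz, hne⟩ := hx
  have hq : 0 < (margZ Q z).toReal := ENNReal.toReal_pos (hpos z).ne' (PMF.apply_ne_top _ _)
  have hq' : 0 < (margZ Q z').toReal := ENNReal.toReal_pos (hpos z').ne' (PMF.apply_ne_top _ _)
  have hQ : ∀ y, (Q (y, z)).toReal / (margZ Q z).toReal =
      (Q (y, z')).toReal / (margZ Q z').toReal := fun y => by
    rw [← ENNReal.toReal_div, ← ENNReal.toReal_div]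
    exact congrArg ENNReal.toReal (congrFun hzz y)
  have hd : (P x z).toReal / (margZ Q z).toReal - (P x z').toReal / (margZ Q z').toReal ≠ 0 := by
    rw [← ENNReal.toReal_div, ← ENNReal.toReal_div, sub_ne_zero]
    intro h
    exact hne ((ENNReal.toReal_eq_toReal_iff'
      (ENNReal.div_ne_top ((P x).apply_ne_top z) (hpos z).ne')
      (ENNReal.div_ne_top ((P x).apply_ne_top z') (hpos z').ne')).1 h)
  set q := (margZ Q z).toReal
  set q' := (margZ Q z').toReal
  refine ⟨2 * (1 / q + 1 / q') ^ 2 / ((P x z).toReal / q - (P x z').toReal / q') ^ 2,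
    fun S δ hδ h => ?_⟩
  have hE := abs_sub_le_of_relEnt_le hδ h
  have ho : ∀ y z, (output S (prodChannel P P) (y, z)).toReal =
      ∑ x, (S x).toReal * ((P x y).toReal * (P x z).toReal) := fun y z => by
    simp only [toReal_output_apply, prodChannel_apply, ENNReal.toReal_mul]
  set o := fun y z => (output S (prodChannel P P) (y, z)).toReal
  -- Expanding the square gives products of two values of the same channel, whose averages are joint
  -- output probabilities.
  have hsum : ∑ x, (S x).toReal * ((P x z).toReal / q - (P x z').toReal / q') ^ 2 =
      1 / q * (1 / q) * o z z - 1 / q * (1 / q') * o z z' - 1 / q' * (1 / q) * o z' z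
        + 1 / q' * (1 / q') * o z' z' := by
    simp only [o, ho, Finset.mul_sum]
    rw [← Finset.sum_sub_distrib, ← Finset.sum_sub_distrib, ← Finset.sum_add_distrib]
    exact Finset.sum_congr rfl fun x _ => by ring
  have h1 := hQ z
  have h2 := hQ z'
  have hle : ∑ x, (S x).toReal * ((P x z).toReal / q - (P x z').toReal / q') ^ 2 ≤
      2 * (1 / q + 1 / q') ^ 2 * √δ := by
    have e1 := (abs_le.1 (hE (z, z))).2
    have e2 := (abs_le.1 (hE (z, z'))).1
    have e3 := (abs_le.1 (hE (z', z))).1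
    have e4 := (abs_le.1 (hE (z', z'))).2
    have hz : 1 / q * (1 / q) * (Q (z, z)).toReal - 1 / q * (1 / q') * (Q (z, z')).toReal
        - 1 / q' * (1 / q) * (Q (z', z)).toReal + 1 / q' * (1 / q') * (Q (z', z')).toReal = 0 := by
      -- At `Q` the form vanishes, by the equivalence of `z` and `z'` tested at the first
      -- coordinates `z` and `z'`.
      linear_combination 1 / q * h1 - 1 / q' * h2
    have a1 : 0 < 1 / q := by positivity
    have a2 : 0 < 1 / q' := by positivity
    rw [hsum]
    simp only [o]
    generalize 1 / q = u at *
    generalize 1 / q' = v at *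
    have m1 := mul_le_mul_of_nonneg_left e1 (mul_pos a1 a1).le
    have m2 := mul_le_mul_of_nonneg_left e2 (mul_pos a1 a2).le
    have m3 := mul_le_mul_of_nonneg_left e3 (mul_pos a2 a1).le
    have m4 := mul_le_mul_of_nonneg_left e4 (mul_pos a2 a2).le
    linarith
  rw [div_mul_eq_mul_div, le_div_iff₀ (by positivity)]
  exact (Finset.single_le_sum (f := fun x => (S x).toReal *
    ((P x z).toReal / q - (P x z').toReal / q') ^ 2) (fun _ _ => by positivity)
    (Finset.mem_univ x)).trans hle

theorem delta_isBigO {X A : Type*} [Fintype X] [Fintype A] {P : Channel X A}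
    {Q : PMF (A × A)} (hpos : ∀ z, 0 < margZ Q z) :
    (fun δ : ℝ => (Delta (prodChannel P P) Q (bad P Q) δ).toReal) =O[𝓝[>] 0]
      fun δ : ℝ => √δ := by
  classical
  have hM : ∀ x, ∃ M : ℝ, x ∈ bad P Q → ∀ (S : PMF X) (δ : ℝ), 0 ≤ δ →
      relEnt (output S (prodChannel P P)) Q ≤ ENNReal.ofReal δ → (S x).toReal ≤ M * √δ := by
    intro x
    by_cases hx : x ∈ bad P Q
    · exact (exists_bound_of_mem_bad hpos hx).imp fun M h _ => h
    · exact ⟨0, fun h => absurd h hx⟩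
  choose M hM using hM
  -- The chosen `M x` is unconstrained at good letters, hence the absolute values.
  refine Asymptotics.IsBigO.of_bound (∑ x, |M x|) ?_
  filter_upwards [self_mem_nhdsWithin] with δ hδ
  rw [Real.norm_of_nonneg ENNReal.toReal_nonneg, Real.norm_of_nonneg (Real.sqrt_nonneg δ)]
  refine ENNReal.toReal_le_of_le_ofReal (by positivity) (iSup₂_le fun S hS => ?_)
  rw [PMF.toOuterMeasure_apply, tsum_fintype, Finset.sum_mul,
    ENNReal.ofReal_sum_of_nonneg fun x _ => by positivity]
  refine Finset.sum_le_sum fun x _ => Set.indicator_apply_le' (fun hx => ?_) fun _ => zero_le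
  rw [← ENNReal.ofReal_toReal (S.apply_ne_top x)]
  refine ENNReal.ofReal_le_ofReal ((hM x hx S δ (le_of_lt hδ) hS).trans ?_)
  gcongr
  exact le_abs_self _

/-- The case δ = 0 of the mass bound, applied to the law that produces `Q` itself. -/
theorem notMem_bad_of_output_eq {X A : Type*} [Fintype X] [Fintype A] {P : Channel X A}
    {S : PMF X} (hpos : ∀ z, 0 < margZ (output S (prodChannel P P)) z) {x : X} (hx : S x ≠ 0) :
    x ∉ bad P (output S (prodChannel P P)) := by
  intro hb
  obtain ⟨M, hM⟩ := exists_bound_of_mem_bad hpos hb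
  have := hM S 0 le_rfl (by simp [relEnt_self])
  rw [Real.sqrt_zero, mul_zero] at this
  exact absurd (ENNReal.toReal_pos hx (S.apply_ne_top x)) this.not_gt

/-! ### Merging equivalent letters. -/

theorem apply_le_map_apply {α β : Type*} (Q : PMF α) (f : α → β) (a : α) :
    Q a ≤ Q.map f (f a) := by
  classical
  rw [PMF.map_apply]
  refine le_trans (le_of_eq ?_) (ENNReal.le_tsum a)
  simp

theorem output_prodChannel_swap {X A : Type*} [Fintype X] (S : PMF X) (P : Channel X A) (y z : A) :
    output S (prodChannel P P) (y, z) = output S (prodChannel P P) (z, y) := by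
  simp only [output_apply, prodChannel_apply, mul_comm]

theorem margY_eq_margZ {A : Type*} {Q : PMF (A × A)} (h : ∀ y z, Q (y, z) = Q (z, y)) :
    margY Q = margZ Q := by
  have hs : Q.map Prod.swap = Q := by
    ext ⟨y, z⟩
    classical
    rw [PMF.map_apply, tsum_eq_single (z, y)]
    · simp [h]
    · rintro ⟨a, b⟩ hab
      rw [if_neg]
      simp only [Prod.swap_prod_mk, Prod.mk.injEq]
      rintro ⟨rfl, rfl⟩
      exact hab rfl
  rw [margY, margZ]
  conv_lhs => rw [← hs, PMF.map_comp]
  rfl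

/-- Cross-multiplied form of: if `p / m` and the conditionals of `Q` agree on `y, y'` and on `z, z'`,
then so do the likelihood ratios `p ⊗ p / Q`. -/
theorem mul_mul_eq_of_cross {A : Type*} {p m : A → ℝ≥0∞} {Q : A × A → ℝ≥0∞} (hm : ∀ a, m a ≠ 0)
    (hm' : ∀ a, m a ≠ ⊤) {y y' z z' : A} (hy : p y * m y' = p y' * m y)
    (hz : p z * m z' = p z' * m z) (hQy : Q (y, z) * m y' = Q (y', z) * m y)
    (hQz : Q (y', z) * m z' = Q (y', z') * m z) :
    p y * p z * Q (y', z') = p y' * p z' * Q (y, z) := by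
  refine (ENNReal.mul_left_inj (mul_ne_zero (hm y') (hm z'))
    (ENNReal.mul_ne_top (hm' y') (hm' z'))).1 ?_
  calc p y * p z * Q (y', z') * (m y' * m z')
      = (p y * m y') * (p z * m z') * Q (y', z') := by ring
    _ = p y' * p z' * m y * (Q (y', z') * m z) := by rw [hy, hz]; ring
    _ = p y' * p z' * (Q (y', z) * m y) * m z' := by rw [← hQz]; ring
    _ = p y' * p z' * Q (y, z) * (m y' * m z') := by rw [← hQy]; ring

theorem mul_eq_mul_of_div_eq_div {a b c d : ℝ≥0∞} (hb : b ≠ 0) (hb' : b ≠ ⊤) (hd : d ≠ 0)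
    (hd' : d ≠ ⊤) (h : a / b = c / d) : a * d = c * b := by
  rw [ENNReal.div_eq_div_iff hd hd' hb hb'] at h
  rw [mul_comm a, h, mul_comm]

theorem relEnt_map_under {X A : Type*} [Fintype X] [Fintype A] {P : Channel X A} {S : PMF X}
    (hpos : ∀ z, 0 < margZ (output S (prodChannel P P)) z)
    (hac : ∀ x a, output S (prodChannel P P) a = 0 → prodChannel P P x a = 0)
    {x : X} (hx : S x ≠ 0) :
    relEnt ((prodChannel P P x).map (under (output S (prodChannel P P))))
      ((output S (prodChannel P P)).map (under (output S (prodChannel P P)))) =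
    relEnt (prodChannel P P x) (output S (prodChannel P P)) := by
  have hgood := notMem_bad_of_output_eq hpos hx
  have hswap := output_prodChannel_swap S P
  set Q := output S (prodChannel P P)
  have : Fintype (Quotient (equivY Q)) := Fintype.ofFinite _
  have : Fintype (Quotient (equivZ Q)) := Fintype.ofFinite _
  have hm := fun a => (hpos a).ne'
  have hm' := fun a => (margZ Q).apply_ne_top a
  have hp : ∀ z z', equivZ Q z z' → P x z * margZ Q z' = P x z' * margZ Q z := by
    intro z z' h
    by_contra hne
    refine hgood ⟨z, z', fun h' => hne (by rw [h']), h, fun h' => hne ?_⟩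
    exact mul_eq_mul_of_div_eq_div (hm _) (hm' _) (hm _) (hm' _) h'
  have hQ : ∀ z z', equivZ Q z z' → ∀ y, Q (y, z) * margZ Q z' = Q (y, z') * margZ Q z :=
    fun z z' h y => mul_eq_mul_of_div_eq_div (hm _) (hm' _) (hm _) (hm' _) (congrFun h y)
  -- `Q` is symmetric, so the two equivalence relations agree and goodness of `x` controls both
  -- coordinates.
  have hYZ : ∀ y y', equivY Q y y' → equivZ Q y y' := by
    intro y y' h
    refine funext fun z => ?_
    have := congrFun h z
    simp only [margY_eq_margZ hswap] at this
    simpa only [hswap z] using this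
  refine relEnt_map_eq _ (hac x) ?_
  rintro ⟨y, z⟩ ⟨y', z'⟩ hyz
  obtain ⟨h1, h2⟩ := Prod.mk.inj hyz
  have hy := hYZ _ _ (Quotient.exact h1)
  have hz : equivZ Q z z' := Quotient.exact h2
  rw [prodChannel_apply, prodChannel_apply]
  refine mul_mul_eq_of_cross hm hm' (hp _ _ hy) (hp _ _ hz) ?_ (hQ _ _ hz y')
  rw [hswap y z, hswap y' z]
  exact hQ _ _ hy z

end DMC

/-! ### Assembly of the theorem. -/

theorem mainTheorem8 {X A : Type*} [Finite X] [Nonempty X] [Finite A]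
    (PY PZ : DMC.Channel X A) (hcovY : DMC.Covers PY) (hcovZ : DMC.Covers PZ)
    (hsymm : PY = PZ) :
    (∃! Q : PMF (A × A), DMC.IsCAOD (DMC.prodChannel PY PZ) Q) ∧
    ∀ Q : PMF (A × A), DMC.IsCAOD (DMC.prodChannel PY PZ) Q →
      (∀ y, 0 < DMC.margY Q y) ∧ (∀ z, 0 < DMC.margZ Q z) ∧
      ((fun δ : ℝ => (DMC.Delta (DMC.prodChannel PY PZ) Q (DMC.bad PZ Q) δ).toReal)
          =O[𝓝[>] 0] fun δ : ℝ => Real.sqrt δ) ∧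
      DMC.capacity (fun x => (DMC.prodChannel PY PZ x).map (DMC.under Q)) =
        DMC.capacity (DMC.prodChannel PY PZ) ∧
      ∀ R : PMF (Quotient (DMC.equivY Q) × Quotient (DMC.equivZ Q)),
        DMC.IsCAOD (fun x => (DMC.prodChannel PY PZ x).map (DMC.under Q)) R ↔
          R = Q.map (DMC.under Q) := by
  open DMC in
  subst hsymm
  have := Fintype.ofFinite X
  have := Fintype.ofFinite A
  obtain ⟨S, hS⟩ := exists_isSaddle (prodChannel PY PY)
  refine ⟨⟨_, (hS.isCAOD_iff _).2 rfl, fun R hR => (hS.isCAOD_iff R).1 hR⟩, fun Q hQ => ?_⟩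
  obtain rfl := (hS.isCAOD_iff Q).1 hQ
  have hac : ∀ x a, output S (prodChannel PY PY) a = 0 → prodChannel PY PY x a = 0 :=
    fun x a => eq_zero_of_relEnt_ne_top (ne_top_of_le_ne_top (mutualInfo_ne_top _ S) (hS x))
  -- An input that reaches `y` gives the pair (y, y) the squared, hence positive, probability; this
  -- makes both marginals positive.
  have hdiag : ∀ y, 0 < output S (prodChannel PY PY) (y, y) := by
    intro y
    obtain ⟨x, hx⟩ := hcovY y
    refine pos_iff_ne_zero.2 fun h => ?_
    have := hac x _ h
    rw [prodChannel_apply] at this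
    exact hx.ne' (mul_self_eq_zero.1 this)
  have hposZ : ∀ z, 0 < margZ (output S (prodChannel PY PY)) z := fun z =>
    (hdiag z).trans_le (apply_le_map_apply _ Prod.snd (z, z))
  refine ⟨fun y => (hdiag y).trans_le (apply_le_map_apply _ Prod.fst (y, y)), hposZ,
    delta_isBigO hposZ, ?_⟩
  have hrel := fun x => relEnt_map_under (x := x) hposZ hac
  set Q := output S (prodChannel PY PY) with hQdef
  have : Fintype (Quotient (equivY Q)) := Fintype.ofFinite _
  have : Fintype (Quotient (equivZ Q)) := Fintype.ofFinite _
  have hout : output S (fun x => (prodChannel PY PY x).map (under Q)) = Q.map (under Q) :=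
    (PMF.map_bind _ _ _).symm
  have hinfo : mutualInfo S (fun x => (prodChannel PY PY x).map (under Q)) =
      mutualInfo S (prodChannel PY PY) := by
    rw [mutualInfo, mutualInfo, condRelEnt_eq_sum, condRelEnt_eq_sum, hout]
    refine Finset.sum_congr rfl fun x _ => ?_
    by_cases hx : S x = 0
    · simp [hx]
    · rw [hrel x hx]
  -- Equality on the support of `S` has fixed the mutual information; for all other letters data
  -- processing is enough.
  have hS' : IsSaddle (fun x => (prodChannel PY PY x).map (under Q)) S := fun x => by
    rw [hinfo, hout]
    exact (relEnt_map_le _ _ _).trans (hS x)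
  refine ⟨by rw [hS'.capacity_eq, hS.capacity_eq, hinfo], fun R => ?_⟩
  rw [hS'.isCAOD_iff, hout]
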